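/- For a prime power $q$ let $P\in\mathbb F_q[x,y]$ satisfy $P(0,0)=0$ and $\frac{\partial P}{\partial y}(0,0)\neq 0$, and let $F=\sum_{n\ge 0}a(n)x^n\in\mathbb F_q[[x]]$ be the Furstenberg series of $P$, i.e. the unique power series with $F(0)=0$ and $P(x,F)=0$. Let $h=\deg_x P$ be the height and $d=\deg_y P$ the degree of $P$. The minimal $q$-automaton of $a(n)_{n\ge0}$ is the smallest deterministic finite automaton with output, with input alphabet $\{0,\dots,q-1\}$, that outputs $a(n)$ when fed the standard base-$q$ representation of $n$ starting with the least significant digit, and whose output is not affected by leading zeros; the $q$-kernel of $a(n)_{n\ge 0}$ is the set of sequences $\{a(q^e n+r)_{n\ge0} : e\ge 0,\ 0\le r\le q^e-1\}$. Then the number of states of the minimal $q$-automaton of $a(n)_{n\ge0}$, and likewise the number of elements of the $q$-kernel of $a(n)_{n\ge0}$, is finite and at most $(1+o(1))\,q^{hd}$ as any one of $q$, $h$, $d$ tends to infinity and the other two remain constant. That is, there is a function $\varepsilon(q,h,d)$, which depends only on $q$, $h$ and $d$, such that both numbers are at most $(1+\varepsilon(q,h,d))\,q^{hd}$ for all such $q$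 and $P$, and such that $\varepsilon(q,h,d)\to0$ as any one of $q$, $h$, $d$ tends to infinity while the other two are fixed. -/

import Mathlib

open Filter Topology

/-- The height `deg_x P` of a bivariate polynomial `P ∈ K[x][y]`: the inner variable is `x`, the
outer variable is `y`. (The degree `deg_y P` is `P.natDegree`.) -/
noncomputable def bivariateHeight {K : Type*} [Semiring K] (P : Polynomial (Polynomial K)) : ℕ :=
  P.support.sup fun j => (P.coeff j).natDegree

/-- `F` is the Furstenberg series associated with `P`: we have `P(0, 0) = 0` and
`(∂P/∂y)(0, 0) ≠ 0`, and `F` is the (unique) power series with `F(0) = 0` and `P(x, F) = 0`. -/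
structure IsFurstenbergSeries {K : Type*} [Field K] (P : Polynomial (Polynomial K))
    (F : PowerSeries K) : Prop where
  eval_zero : Polynomial.evalEval 0 0 P = 0
  derivative_ne_zero : Polynomial.evalEval 0 0 (Polynomial.derivative P) ≠ 0
  constantCoeff_eq_zero : PowerSeries.constantCoeff F = 0
  root : Polynomial.aevalAeval (PowerSeries.X : PowerSeries K) F P = 0

/-- The `q`-kernel `{(a(q^e n + r))_{n ≥ 0} : e ≥ 0, 0 ≤ r ≤ q^e - 1}` of a sequence. -/
def qKernel {A : Type*} (q : ℕ) (a : ℕ → A) : Set (ℕ → A) :=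
  {b | ∃ e r : ℕ, r < q ^ e ∧ b = fun n => a (q ^ e * n + r)}

/-- Deterministic automata with output in `A`, input alphabet `{0, …, q - 1}` and set of
states `σ`. -/
structure AutomatonWithOutput (q : ℕ) (A : Type*) (σ : Type*) where
  start : σ
  step : σ → Fin q → σ
  output : σ → A

namespace AutomatonWithOutput

variable {q : ℕ} {A σ : Type*}

/-- The output of the automaton when fed the word `w` (the head of the list is read first). -/
def run (M : AutomatonWithOutput q A σ) (w : List (Fin q)) : A :=
  M.output (w.foldl M.step M.start)

/-- `a(n)` is the output on the standard base-`q` representation of `n`, read starting with the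
least significant digit (the order of `Nat.digits`; the representation of `0` is empty). -/
def Generates (M : AutomatonWithOutput q A σ) (a : ℕ → A) : Prop :=
  ∀ (n : ℕ) (w : List (Fin q)), w.map Fin.val = Nat.digits q n → M.run w = a n

/-- The automaton is not affected by leading zeros. The least significant digit is read first,
so the leading zeros of a representation are the last letters of the word. -/
def IgnoresLeadingZeros (M : AutomatonWithOutput q A σ) : Prop :=
  ∀ (w : List (Fin q)) (z : Fin q) (k : ℕ), z.val = 0 → M.run (w ++ List.replicate k z) = M.run w

end AutomatonWithOutput

/-- `s` is the size (number of states) of the minimal `q`-automaton of `a`, that is, of the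
smallest finite automaton that generates `a` and is not affected by leading zeros. In particular
such an automaton exists. -/
def IsMinimalAutomatonSize {A : Type*} (q : ℕ) (a : ℕ → A) (s : ℕ) : Prop :=
  IsLeast {N : ℕ | ∃ M : AutomatonWithOutput q A (Fin N),
    M.Generates a ∧ M.IgnoresLeadingZeros} s

/-! Write $\Lambda_r$ for the map sending $\sum a(n)x^n$ to $\sum a(qn+r)x^n$; the $q$-kernel is the
orbit of $F$ under these maps. Every element of it has the form $S(x,F)/P_y(x,F)$ with $S$ a
polynomial: $F$ itself has $S_0=yP_y-dP$, and $\Lambda_r$ replaces $S$ by the polynomial that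
collects the terms of $SP^{q-1}$ with exponents $\equiv(r,q-1)$ mod $q$ (`decimate_seriesOf`). It is
thus enough to count numerators.

All numerators satisfy $\deg_x S\le h$ and $\deg_y S\le d-1$. A single digit $r\neq0$ forces $\deg_x
S\le h-1$, and this persists, so at most $q^{hd}$ numerators arise in this way (`qKernel_subset`).
What remains is the orbit of $S_0$ under $\Lambda_0$ alone, for which the box bound $q^{(h+1)d}$ is
too weak.

On that orbit the coefficients of $x^0$, of $x^h$ and of $y^{d-1}$ evolve independently of the
interior, each by a Cartier operator in one variable (`iterate_bicartier_boundary`). Such an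
operator is eventually periodic, with any period divisible by the degrees of the irreducible factors
of its denominator (`iterate_cartier_add`): a differential form with simple poles in $\mathbb
F_{q^N}$ and no polynomial part is fixed by the $N$-th iterate. A polynomial of degree $n$ has at
most $\sqrt{2n}$ distinct factor degrees, which gives a common period $N\le n^{\sqrt{2n}}$ with
$n=2(h+d)$. Up to a preperiod of length $h+d$, the orbit therefore lies in $N$ translates of a space
with $(h-1)(d-1)$ free coefficients (`range_iterate_bicartier`).

The total is at most $q^{hd}+(h+d)+Nq^{(h-1)(d-1)}$. Relative to $q^{hd}$ the excess is
subexponential in $h+d$ divided by $q^{h+d-1}$, which gives the three limits. The automaton bound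
follows by taking the kernel as set of states. -/

/-! ### Decimation of power series -/

namespace PowerSeries

/-- The series whose `n`-th coefficient is the `(q n + r)`-th coefficient of `f`. -/
noncomputable def decimate {R : Type*} [Semiring R] (q r : ℕ) (f : PowerSeries R) :
    PowerSeries R :=
  mk fun n => coeff (q * n + r) f

section Semiring

variable {R : Type*} [Semiring R]

@[simp]
lemma coeff_decimate (q r n : ℕ) (f : PowerSeries R) :
    coeff n (decimate q r f) = coeff (q * n + r) f := by
  simp [decimate]

lemma decimate_sum {ι : Type*} (q r : ℕ) (s : Finset ι) (f : ι → PowerSeries R) :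
    decimate q r (∑ i ∈ s, f i) = ∑ i ∈ s, decimate q r (f i) := by
  ext n; simp

end Semiring

/-- Exponents of `expand q hq g` are multiples of $q$, so only terms of $f$ with exponent $\equiv r$
mod $q$ contribute. -/
lemma decimate_mul_expand {R : Type*} [CommRing R] {q r : ℕ} (hq : q ≠ 0) (hr : r < q)
    (f g : PowerSeries R) : decimate q r (f * expand q hq g) = decimate q r f * g := by
  ext n
  rw [coeff_decimate, coeff_mul, coeff_mul]
  symm
  apply Finset.sum_of_injOn (fun x : ℕ × ℕ => (q * x.1 + r, q * x.2))
  · rintro ⟨a, b⟩ - ⟨c, d⟩ - h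
    simp only [Prod.mk.injEq, Nat.add_right_cancel_iff] at h
    have := Nat.eq_of_mul_eq_mul_left (Nat.pos_of_ne_zero hq) h.1
    have := Nat.eq_of_mul_eq_mul_left (Nat.pos_of_ne_zero hq) h.2
    simp_all
  · rintro ⟨a, b⟩ h
    rw [Finset.mem_coe, Finset.HasAntidiagonal.mem_antidiagonal] at h ⊢
    rw [← h]; ring
  · rintro ⟨a, b⟩ h hn
    rw [Finset.HasAntidiagonal.mem_antidiagonal] at h
    dsimp only at h ⊢
    rw [coeff_expand, if_neg, mul_zero]
    rintro ⟨c, rfl⟩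
    apply hn
    have hc : c ≤ n := by
      by_contra hc
      have : q * (n + 1) ≤ q * c := Nat.mul_le_mul_left _ (by omega)
      rw [mul_add] at this
      omega
    obtain ⟨k, rfl⟩ := Nat.exists_eq_add_of_le hc
    refine ⟨(k, c), by simp [add_comm], ?_⟩
    rw [mul_add] at h
    simp only [Prod.mk.injEq, and_true]
    omega
  · rintro ⟨a, b⟩ -
    simp

/-- The $q$-power Frobenius fixes the coefficients, which lie in $\mathbb F_q$. -/
lemma expand_card {K : Type*} [Field K] [Fintype K] (g : PowerSeries K) :
    expand (Fintype.card K) Fintype.card_ne_zero g = g ^ Fintype.card K := by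
  obtain ⟨p, hp⟩ := CharP.exists K
  obtain ⟨n, hprime, hn⟩ := FiniteField.card K p
  have : Fact p.Prime := ⟨hprime⟩
  have : ExpChar K p := ExpChar.prime hprime
  have h := MvPowerSeries.map_iterateFrobenius_expand (σ := Unit) p hprime.ne_zero g n
  have hid : iterateFrobenius K p n = RingHom.id K := by
    ext x
    rw [iterateFrobenius_def, ← hn, FiniteField.pow_card, RingHom.id_apply]
  rw [hid, MvPowerSeries.map_id, RingHom.id_apply] at h
  simp only [← hn] at h
  exact h

lemma decimate_mul_pow_card {K : Type*} [Field K] [Fintype K] {r : ℕ} (hr : r < Fintype.card K)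
    (f g : PowerSeries K) :
    decimate (Fintype.card K) r (f * g ^ Fintype.card K) = decimate (Fintype.card K) r f * g := by
  rw [← expand_card, decimate_mul_expand _ hr]

end PowerSeries

/-! ### Decimation of polynomials in one and two variables -/

namespace Polynomial

open scoped Polynomial.Bivariate

/-- The polynomial whose `n`-th coefficient is the `(q n + r)`-th coefficient of `f`. -/
noncomputable def decimate {R : Type*} [Semiring R] (q r : ℕ) (f : R[X]) : R[X] :=
  ∑ n ∈ Finset.range (f.natDegree + 1), monomial n (f.coeff (q * n + r))

section Semiring

variable {R : Type*} [Semiring R] {q : ℕ}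

lemma coeff_decimate (hq : q ≠ 0) (r n : ℕ) (f : R[X]) :
    (decimate q r f).coeff n = f.coeff (q * n + r) := by
  simp only [decimate, finsetSum_coeff, coeff_monomial, Finset.sum_ite_eq', Finset.mem_range]
  split_ifs with h
  · rfl
  · rw [coeff_eq_zero_of_natDegree_lt]
    have := Nat.le_mul_of_pos_left n (Nat.pos_of_ne_zero hq)
    omega

@[simp]
lemma decimate_zero (r : ℕ) : decimate q r (0 : R[X]) = 0 := by
  simp [decimate]

lemma decimate_add (hq : q ≠ 0) (r : ℕ) (f g : R[X]) :
    decimate q r (f + g) = decimate q r f + decimate q r g := by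
  ext n; simp [coeff_decimate hq]

lemma decimate_decimate {Q : ℕ} (hq : q ≠ 0) (hQ : Q ≠ 0) (r s : ℕ) (f : R[X]) :
    decimate Q s (decimate q r f) = decimate (q * Q) (q * s + r) f := by
  ext n
  rw [coeff_decimate hQ, coeff_decimate hq, coeff_decimate (mul_ne_zero hq hQ)]
  congr 1
  ring

end Semiring

lemma coe_decimate {R : Type*} [CommSemiring R] {q : ℕ} (hq : q ≠ 0) (r : ℕ) (f : R[X]) :
    (decimate q r f : PowerSeries R) = PowerSeries.decimate q r f := by
  ext n
  simp [coeff_decimate hq]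

lemma decimate_mul_pow_card {K : Type*} [Field K] [Fintype K] {r : ℕ} (hr : r < Fintype.card K)
    (f g : K[X]) :
    decimate (Fintype.card K) r (f * g ^ Fintype.card K) = decimate (Fintype.card K) r f * g := by
  rw [← coe_inj, coe_mul, coe_decimate Fintype.card_ne_zero, coe_decimate Fintype.card_ne_zero,
    coe_mul, coe_pow, PowerSeries.decimate_mul_pow_card hr]

/-- The polynomial in two variables whose coefficient of `x^m y^n` is the coefficient of
`x^(q m + r) y^(q n + s)` in `f`. -/
noncomputable def bidecimate {R : Type*} [Semiring R] (q r s : ℕ) (f : R[X][Y]) : R[X][Y] :=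
  ∑ n ∈ Finset.range (f.natDegree + 1), monomial n (decimate q r (f.coeff (q * n + s)))

lemma coeff_bidecimate {R : Type*} [Semiring R] {q : ℕ} (hq : q ≠ 0) (r s n : ℕ) (f : R[X][Y]) :
    (bidecimate q r s f).coeff n = decimate q r (f.coeff (q * n + s)) := by
  simp only [bidecimate, finsetSum_coeff, coeff_monomial, Finset.sum_ite_eq', Finset.mem_range]
  split_ifs with h
  · rfl
  · rw [coeff_eq_zero_of_natDegree_lt, decimate_zero]
    have := Nat.le_mul_of_pos_left n (Nat.pos_of_ne_zero hq)
    omega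

end Polynomial

/-! ### Cartier operators in one variable and their eventual periodicity -/

namespace Polynomial

section Cartier

variable {K : Type*} [Field K] [Fintype K]

/-- The action on numerators of the Cartier operator on differential forms `T / R dy`. -/
noncomputable def cartier (R T : K[X]) : K[X] :=
  decimate (Fintype.card K) (Fintype.card K - 1) (T * R ^ (Fintype.card K - 1))

/-- The operator depends only on the fraction $T/R$: a common factor contributes $g^q$, which leaves
the decimation as $g$. This allows denominators to be enlarged at will. -/
lemma cartier_mul_mul (g R T : K[X]) : cartier (g * R) (g * T) = g * cartier R T := by
  have hq : Fintype.card K - 1 + 1 = Fintype.card K := Nat.sub_add_cancel Fintype.card_pos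
  have h : g * T * (g * R) ^ (Fintype.card K - 1)
      = T * R ^ (Fintype.card K - 1) * g ^ Fintype.card K := by
    conv_rhs => rw [← hq]
    rw [Nat.add_sub_cancel, pow_succ, mul_pow]
    ring
  rw [cartier, h, decimate_mul_pow_card (Nat.sub_lt Fintype.card_pos one_pos), mul_comm, cartier]

lemma iterate_cartier_mul_mul (g R T : K[X]) (k : ℕ) :
    (cartier (g * R))^[k] (g * T) = g * (cartier R)^[k] T := by
  have h : Function.Semiconj (fun T => g * T) (cartier R) (cartier (g * R)) :=
    fun T => (cartier_mul_mul g R T).symm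
  exact ((h.iterate_right k) T).symm

lemma iterate_cartier (R T : K[X]) (k : ℕ) :
    (cartier R)^[k] T
      = decimate (Fintype.card K ^ k) (Fintype.card K ^ k - 1)
          (T * R ^ (Fintype.card K ^ k - 1)) := by
  induction k generalizing T with
  | zero =>
    ext n
    rw [coeff_decimate (by simp)]
    simp
  | succ k ih =>
    have hq : 0 < Fintype.card K := Fintype.card_pos
    have hk : 0 < Fintype.card K ^ k := pow_pos hq k
    rw [Function.iterate_succ_apply, ih, cartier,
      ← decimate_mul_pow_card (Nat.sub_lt hq one_pos), decimate_decimate hq.ne' hk.ne',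
      ← pow_mul, mul_assoc, ← pow_add, pow_succ']
    have he : Fintype.card K * (Fintype.card K ^ k - 1) + (Fintype.card K - 1)
        = Fintype.card K * Fintype.card K ^ k - 1 := by
      have := Nat.mul_le_mul_left (Fintype.card K) hk
      rw [Nat.mul_sub]
      omega
    rw [he, ← he]
    congr 3
    ring

/-- Each step turns $T/M^{q^{k+1}}$ into $\Lambda_{q-1}(T)/M^{q^k}$, so $k$ steps reduce the
denominator to $M$ itself. The quantity $j+1$ is divided by $q$ at each step, hence the form of the
degree bound. -/
lemma exists_iterate_cartier_pow (M T : K[X]) (D k : ℕ)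
    (hT : ∀ j, T.coeff j ≠ 0 → j + 1 < (D + 1) * Fintype.card K ^ k) :
    ∃ U : K[X], (cartier (M ^ Fintype.card K ^ k))^[k] T = M ^ (Fintype.card K ^ k - 1) * U ∧
      ∀ j, U.coeff j ≠ 0 → j < D := by
  induction k generalizing T with
  | zero => exact ⟨T, by simp, fun j hj => by simpa using hT j hj⟩
  | succ k ih =>
    have hq : 0 < Fintype.card K := Fintype.card_pos
    have hk : 0 < Fintype.card K ^ k := pow_pos hq k
    obtain ⟨U, hU, hD⟩ := ih (decimate (Fintype.card K) (Fintype.card K - 1) T) fun j hj => by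
      rw [coeff_decimate hq.ne'] at hj
      have := hT _ hj
      have h : Fintype.card K * (j + 1) < Fintype.card K * ((D + 1) * Fintype.card K ^ k) := by
        calc _ = Fintype.card K * j + (Fintype.card K - 1) + 1 := by rw [mul_add]; omega
          _ < _ := this
          _ = _ := by ring
      exact Nat.lt_of_mul_lt_mul_left h
    refine ⟨U, ?_, hD⟩
    have h1 : cartier (M ^ Fintype.card K ^ (k + 1)) T
        = (M ^ Fintype.card K ^ k) ^ (Fintype.card K - 1)
          * decimate (Fintype.card K) (Fintype.card K - 1) T := by
      rw [cartier, mul_comm _ (decimate _ _ _), ← decimate_mul_pow_card (Nat.sub_lt hq one_pos)]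
      congr 2
      rw [← pow_mul, ← pow_mul, ← pow_mul, pow_succ]
      congr 1
      ring
    have h2 : M ^ Fintype.card K ^ (k + 1)
        = (M ^ Fintype.card K ^ k) ^ (Fintype.card K - 1) * M ^ Fintype.card K ^ k := by
      rw [← pow_succ, Nat.sub_add_cancel hq, ← pow_mul, pow_succ]
    rw [Function.iterate_succ_apply, h1, h2, iterate_cartier_mul_mul, hU, ← mul_assoc, ← pow_mul,
      ← pow_add]
    congr 2
    have := Nat.mul_le_mul_left (Fintype.card K ^ k) hq
    rw [Nat.mul_sub, pow_succ]
    omega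

/-- With $Q=q^N$, both sides times $X^Q-X$ equal $X^{Q^2}-X^Q$, by a geometric sum and by Frobenius.
-/
lemma X_pow_card_pow_sub_X_pow (N : ℕ) (hN : N ≠ 0) :
    ((X : K[X]) ^ Fintype.card K ^ N - X) ^ (Fintype.card K ^ N - 1)
      = ∑ k ∈ Finset.range (Fintype.card K ^ N),
          X ^ (Fintype.card K ^ N * k + (Fintype.card K ^ N - 1 - k)) := by
  obtain ⟨p, hp⟩ := CharP.exists K
  obtain ⟨n, hprime, hn⟩ := FiniteField.card K p
  have : Fact p.Prime := ⟨hprime⟩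
  have hne := FiniteField.X_pow_card_pow_sub_X_ne_zero K hN (Fintype.one_lt_card (α := K))
  apply mul_right_cancel₀ hne
  rw [← pow_succ, Nat.sub_add_cancel (pow_pos Fintype.card_pos N)]
  simp only [pow_add, pow_mul]
  rw [Commute.geom_sum₂_mul (Commute.all _ _), hn, ← pow_mul, sub_pow_char_pow]

/-- The form $U\,dX/(X^Q-X)$ has simple poles at elements of $\mathbb F_Q$, and its residues are
fixed by the $Q$-power Frobenius. In coefficients, the $k$-th term of the geometric sum contributes
the coefficient of $U$ at $Q(n-k)+k$, and the degree bound leaves only $k=n$. -/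
lemma iterate_cartier_X_pow_card_pow_sub_X (U : K[X]) (N : ℕ) (hN : N ≠ 0)
    (hU : ∀ j, U.coeff j ≠ 0 → j < Fintype.card K ^ N) :
    (cartier (X ^ Fintype.card K ^ N - X))^[N] U = U := by
  have hQ : 0 < Fintype.card K ^ N := pow_pos Fintype.card_pos N
  rw [iterate_cartier, X_pow_card_pow_sub_X_pow N hN]
  set Q := Fintype.card K ^ N
  ext n
  rw [coeff_decimate hQ.ne', Finset.mul_sum, finsetSum_coeff]
  simp only [coeff_mul_X_pow']
  have hU' : ∀ j, Q ≤ j → U.coeff j = 0 := fun j hj => by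
    by_contra h
    exact absurd (hU j h) (not_lt.2 hj)
  by_cases hn : n < Q
  · rw [Finset.sum_eq_single_of_mem n (Finset.mem_range.2 hn), if_pos (by omega)]
    · congr 1; omega
    · intro k hk hkn
      rw [Finset.mem_range] at hk
      split_ifs with h
      · apply hU'
        obtain hlt | hlt := Nat.lt_or_gt_of_ne hkn
        · have := Nat.mul_le_mul_left Q (Nat.succ_le_of_lt hlt)
          rw [Nat.mul_succ] at this
          omega
        · have := Nat.mul_le_mul_left Q (Nat.succ_le_of_lt hlt)
          rw [Nat.mul_succ] at this
          omega
      · rfl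
  · rw [hU' n (not_lt.1 hn)]
    refine Finset.sum_eq_zero fun k hk => ?_
    rw [Finset.mem_range] at hk
    split_ifs with h
    · apply hU'
      have := Nat.mul_le_mul_left Q (Nat.succ_le_of_lt (hk.trans_le (not_lt.1 hn)))
      rw [Nat.mul_succ] at this
      omega
    · rfl

lemma dvd_pow_natDegree_of_forall_irreducible {F : Type*} [Field F] {R M : F[X]} (hR : R ≠ 0)
    (h : ∀ f : F[X], Irreducible f → f ∣ R → f ∣ M) : R ∣ M ^ R.natDegree := by
  induction R using WfDvdMonoid.induction_on_irreducible with
  | zero => exact absurd rfl hR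
  | unit u hu => exact hu.dvd
  | mul a i ha hi ih =>
    rw [natDegree_mul hi.ne_zero ha, pow_add]
    refine mul_dvd_mul ?_ (ih ha fun f hf hfa => h f hf (hfa.mul_left _))
    exact dvd_pow (h i hi (dvd_mul_right _ _)) hi.natDegree_pos.ne'

/-- The Cartier operator is eventually periodic, with a period that is divisible by the degrees of
the irreducible factors of the denominator. -/
theorem iterate_cartier_add {R T : K[X]} {m N k : ℕ} (hR : R ≠ 0) (hRm : R.natDegree ≤ m)
    (hT : ∀ j, T.coeff j ≠ 0 → j < m) (hm : m < Fintype.card K ^ k) (hN : N ≠ 0)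
    (hdvd : ∀ f : K[X], Irreducible f → f ∣ R → f.natDegree ∣ N) :
    (cartier R)^[N + k] T = (cartier R)^[k] T := by
  set Q := Fintype.card K ^ N with hQdef
  set M : K[X] := X ^ Q - X with hM
  have hM0 : M ≠ 0 := FiniteField.X_pow_card_pow_sub_X_ne_zero K hN Fintype.one_lt_card
  have hMdeg : M.natDegree = Q :=
    FiniteField.X_pow_card_pow_sub_X_natDegree_eq K hN Fintype.one_lt_card
  -- Irreducibles of degree dividing $N$ divide $X^{q^N}-X$, and multiplicities in $R$ are at most
  -- $\deg R\le m<q^k$.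
  have hRM : R ∣ M ^ Fintype.card K ^ k := by
    refine (dvd_pow_natDegree_of_forall_irreducible hR fun f hf hfR => ?_).trans
      (pow_dvd_pow M (hRm.trans hm.le))
    rw [hM, hQdef, ← Nat.card_eq_fintype_card]
    exact hf.natDegree_dvd_iff_dvd_X_pow_card_pow_sub_X.1 (hdvd f hf hfR)
  obtain ⟨g, hg⟩ := hRM
  have hg0 : g ≠ 0 := by
    rintro rfl
    exact pow_ne_zero _ hM0 (by rw [hg, mul_zero])
  have hgdeg : g.natDegree ≤ Q * Fintype.card K ^ k := by
    have := congrArg natDegree hg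
    rw [natDegree_pow, natDegree_mul hR hg0, hMdeg] at this
    rw [mul_comm]
    omega
  apply mul_left_cancel₀ hg0
  rw [← iterate_cartier_mul_mul, ← iterate_cartier_mul_mul, mul_comm g R, ← hg]
  obtain ⟨U, hU, hUQ⟩ := exists_iterate_cartier_pow M (g * T) Q k fun j hj => by
    have h1 : j ≤ g.natDegree + T.natDegree :=
      (le_natDegree_of_ne_zero hj).trans natDegree_mul_le
    have h2 : T.natDegree < m := by
      apply hT
      rw [coeff_natDegree, leadingCoeff_ne_zero]
      rintro rfl
      simp at hj
    rw [add_mul, one_mul]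
    omega
  rw [Function.iterate_add_apply, hU]
  have h3 : M ^ Fintype.card K ^ k = M ^ (Fintype.card K ^ k - 1) * M := by
    rw [← pow_succ, Nat.sub_add_cancel (pow_pos Fintype.card_pos k)]
  rw [h3, iterate_cartier_mul_mul, iterate_cartier_X_pow_card_pow_sub_X U N hN hUQ]

end Cartier

end Polynomial

/-! ### The action of decimation on series $S(x,F)/P_y(x,F)$ -/

namespace Polynomial

open scoped Polynomial.Bivariate

/-- With $Q=p^n$ and $s<Q$, $(X+F)^{Qb+s}=(X^Q+F^Q)^b(X+F)^s$. Below $X^Q$ only $F^{Qb}(X+F)^s$ is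
seen, and it reaches degree $Q-1$ exactly when $s=Q-1$, with coefficient $F^{Qb}$. -/
lemma taylor_coeff_char_pow_sub_one {R : Type*} [CommRing R] [Nontrivial R] (p n : ℕ)
    [Fact p.Prime] [CharP R p] (F : R) (T : R[X]) :
    (taylor F T).coeff (p ^ n - 1) = (decimate (p ^ n) (p ^ n - 1) T).eval (F ^ p ^ n) := by
  have hQ : 0 < p ^ n := pow_pos (Fact.out (p := p.Prime)).pos n
  induction T using Polynomial.induction_on' with
  | add f g hf hg => rw [map_add, coeff_add, hf, hg, decimate_add hQ.ne', eval_add]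
  | monomial j a =>
    have hj : p ^ n * (j / p ^ n) + j % p ^ n = j := Nat.div_add_mod _ _
    have hs : j % p ^ n < p ^ n := Nat.mod_lt _ hQ
    generalize j / p ^ n = b at hj
    generalize j % p ^ n = s at hj hs
    subst hj
    obtain ⟨W, hW⟩ : (X : R[X]) ^ p ^ n ∣ (X ^ p ^ n + C (F ^ p ^ n)) ^ b - C (F ^ p ^ n) ^ b := by
      refine dvd_trans ?_ (sub_dvd_pow_sub_pow _ _ _)
      simp
    have hpow : ((X : R[X]) + C F) ^ (p ^ n * b + s)
        = C ((F ^ p ^ n) ^ b) * (X + C F) ^ s + W * (X + C F) ^ s * X ^ p ^ n := by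
      rw [pow_add, pow_mul, add_pow_char_pow, ← C_pow, sub_eq_iff_eq_add.1 hW]
      simp only [C_pow]
      ring
    have hdec : decimate (p ^ n) (p ^ n - 1) (monomial (p ^ n * b + s) a)
        = if s = p ^ n - 1 then monomial b a else 0 := by
      ext i
      rw [coeff_decimate hQ.ne', coeff_monomial]
      split_ifs with h1 h2 h2
      · subst h2
        have : b = i := Nat.eq_of_mul_eq_mul_left hQ (by omega)
        simp [this]
      · exfalso
        apply h2
        have := congrArg (· % p ^ n) h1
        simpa [Nat.mul_add_mod, Nat.mod_eq_of_lt hs,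
          Nat.mod_eq_of_lt (Nat.sub_lt hQ one_pos)] using this
      · rw [coeff_monomial, if_neg]
        rintro rfl
        exact h1 (by rw [h2])
      · simp
    rw [taylor_monomial, hpow, coeff_C_mul, coeff_add, coeff_C_mul, coeff_mul_X_pow',
      if_neg (by omega), add_zero, coeff_X_add_C_pow, hdec]
    split_ifs with h
    · subst h
      simp
    · rw [Nat.choose_eq_zero_of_lt (by omega)]
      simp

lemma aevalAeval_eq_eval_map {K : Type*} [Field K] (F : PowerSeries K) (T : K[X][Y]) :
    aevalAeval PowerSeries.X F T = (T.map coeToPowerSeries.ringHom).eval F := by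
  induction T using Polynomial.induction_on' with
  | add f g hf hg => rw [map_add, hf, hg, Polynomial.map_add, eval_add]
  | monomial n a =>
    rw [← C_mul_X_pow_eq_monomial, map_mul, map_pow, aevalAeval_C, aevalAeval_Y, Polynomial.map_mul,
      Polynomial.map_pow, map_C, map_X, eval_mul, eval_pow, eval_X, eval_C]
    congr 1
    induction a using Polynomial.induction_on' with
    | add f g hf hg => rw [map_add, hf, hg, map_add]
    | monomial m c =>
      rw [← C_mul_X_pow_eq_monomial, map_mul, map_pow, aeval_X, aeval_C]
      simp

lemma constantCoeff_aevalAeval {K : Type*} [Field K] (F : PowerSeries K) (T : K[X][Y]) :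
    PowerSeries.constantCoeff (aevalAeval PowerSeries.X F T)
      = evalEval 0 (PowerSeries.constantCoeff F) T := by
  induction T using Polynomial.induction_on' with
  | add f g hf hg => rw [map_add, map_add, hf, hg, evalEval_add]
  | monomial n a =>
    rw [aevalAeval_eq_eval_map, map_monomial, eval_monomial, map_mul, map_pow, evalEval,
      eval_monomial, eval_mul, ← C_pow, eval_C, coeToPowerSeries.ringHom_apply,
      constantCoeff_coe, coeff_zero_eq_eval_zero]

section Cartier

variable {K : Type*} [Field K] [Fintype K]

/-- The action on numerators `S` of the Cartier operators, on the series
`S(x, F) / (∂P/∂y)(x, F)`. -/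
noncomputable def bicartier (P : K[X][Y]) (r : ℕ) (S : K[X][Y]) : K[X][Y] :=
  bidecimate (Fintype.card K) r (Fintype.card K - 1) (S * P ^ (Fintype.card K - 1))

/-- The series `S(x, F) / (∂P/∂y)(x, F)`. -/
noncomputable def seriesOf (P : K[X][Y]) (F : PowerSeries K) (S : K[X][Y]) : PowerSeries K :=
  aevalAeval PowerSeries.X F S * (aevalAeval PowerSeries.X F (derivative P))⁻¹

/-- Both sides are the coefficient of $Z^{q-1}$ in $SP^{q-1}$ at $y=F+Z$. Since $P(x,F)=0$, there
$P=Z\,(P_y(x,F)+\cdots)$, which gives the left side. -/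
lemma aevalAeval_mul_pow_card_sub_one {P : K[X][Y]} {F : PowerSeries K}
    (hF : aevalAeval PowerSeries.X F P = 0) (S : K[X][Y]) :
    aevalAeval PowerSeries.X F S
        * aevalAeval PowerSeries.X F (derivative P) ^ (Fintype.card K - 1)
      = (decimate (Fintype.card K) (Fintype.card K - 1)
          ((S * P ^ (Fintype.card K - 1)).map coeToPowerSeries.ringHom)).eval
            (F ^ Fintype.card K) := by
  obtain ⟨p, hp⟩ := CharP.exists K
  obtain ⟨n, hprime, hn⟩ := FiniteField.card K p
  have : Fact p.Prime := ⟨hprime⟩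
  have : CharP (PowerSeries K) p := charP_of_injective_algebraMap
    (FaithfulSMul.algebraMap_injective K (PowerSeries K)) p
  rw [hn, ← taylor_coeff_char_pow_sub_one p n, ← hn]
  set q := Fintype.card K
  set P' := P.map (coeToPowerSeries.ringHom (R := K))
  set S' := S.map (coeToPowerSeries.ringHom (R := K))
  have h0 : (taylor F P').coeff 0 = 0 := by
    rw [taylor_coeff_zero, ← hF, aevalAeval_eq_eval_map]
  have hP : taylor F P' = divX (taylor F P') * X := by
    conv_lhs => rw [← divX_mul_X_add (taylor F P'), h0, C_0, add_zero]
  have h1 : (divX (taylor F P')).coeff 0 = aevalAeval PowerSeries.X F (derivative P) := by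
    rw [coeff_divX, zero_add, taylor_coeff_one, aevalAeval_eq_eval_map, derivative_map]
  rw [Polynomial.map_mul, Polynomial.map_pow, taylor_mul, taylor_pow]
  change _ = (taylor F S' * taylor F P' ^ (q - 1)).coeff (q - 1)
  rw [hP, mul_pow, ← mul_assoc, coeff_mul_X_pow', if_pos le_rfl, Nat.sub_self, mul_coeff_zero,
    coeff_zero_eq_eval_zero (_ ^ _), eval_pow, ← coeff_zero_eq_eval_zero, h1, taylor_coeff_zero,
    aevalAeval_eq_eval_map F S]

lemma decimate_eval_decimate {r : ℕ} (hr : r < Fintype.card K) (F : PowerSeries K)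
    (T : K[X][Y]) :
    PowerSeries.decimate (Fintype.card K) r
        ((decimate (Fintype.card K) (Fintype.card K - 1)
          (T.map coeToPowerSeries.ringHom)).eval (F ^ Fintype.card K))
      = aevalAeval PowerSeries.X F
          (bidecimate (Fintype.card K) r (Fintype.card K - 1) T) := by
  have hq : Fintype.card K ≠ 0 := Fintype.card_ne_zero
  rw [aevalAeval_eq_eval_map]
  set A := decimate (Fintype.card K) (Fintype.card K - 1) (T.map coeToPowerSeries.ringHom)
  set B := (bidecimate (Fintype.card K) r (Fintype.card K - 1) T).map
    (coeToPowerSeries.ringHom (R := K))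
  rw [eval_eq_sum_range' (n := max A.natDegree B.natDegree + 1) (by omega),
    eval_eq_sum_range' (n := max A.natDegree B.natDegree + 1) (by omega),
    PowerSeries.decimate_sum]
  refine Finset.sum_congr rfl fun k _ => ?_
  rw [← pow_mul, mul_comm (Fintype.card K) k, pow_mul, PowerSeries.decimate_mul_pow_card hr,
    coeff_decimate hq, coeff_map, coeff_map, coeff_bidecimate hq, coeToPowerSeries.ringHom_apply,
    coeToPowerSeries.ringHom_apply, coe_decimate hq]

/-- With $u=P_y(x,F)$, a unit, $S(x,F)/u=S(x,F)\,u^{q-1}\cdot(u^{-1})^q$. The $q$-th power leaves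
the decimation as $u^{-1}$, and the remaining factor is a polynomial in $F^q$. -/
theorem decimate_seriesOf {P : K[X][Y]} {F : PowerSeries K} (hF : IsFurstenbergSeries P F) {r : ℕ}
    (hr : r < Fintype.card K) (S : K[X][Y]) :
    PowerSeries.decimate (Fintype.card K) r (seriesOf P F S) = seriesOf P F (bicartier P r S) := by
  have hq : Fintype.card K - 1 + 1 = Fintype.card K := Nat.sub_add_cancel Fintype.card_pos
  have hu : PowerSeries.constantCoeff (aevalAeval PowerSeries.X F (derivative P)) ≠ 0 := by
    rw [constantCoeff_aevalAeval, hF.constantCoeff_eq_zero]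
    exact hF.derivative_ne_zero
  rw [seriesOf, seriesOf, bicartier, ← decimate_eval_decimate hr,
    ← aevalAeval_mul_pow_card_sub_one hF.root, ← PowerSeries.decimate_mul_pow_card hr]
  congr 1
  generalize aevalAeval PowerSeries.X F (derivative P) = u at hu
  have h1 : u ^ (Fintype.card K - 1) * u⁻¹ ^ Fintype.card K = u⁻¹ := by
    conv_lhs => rw [← hq, Nat.add_sub_cancel, pow_succ, ← mul_assoc, ← mul_pow,
      PowerSeries.mul_inv_cancel _ hu, one_pow, one_mul]
  rw [mul_assoc, h1]

end Cartier

end Polynomial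

/-! ### Degree bounds and boundary coefficients of numerators -/

namespace Polynomial

open scoped Polynomial.Bivariate

open Bivariate (swap)

lemma coeff_coeff_swap {R : Type*} [CommSemiring R] (S : R[X][Y]) (i j : ℕ) :
    ((swap S).coeff i).coeff j = (S.coeff j).coeff i := by
  induction S using Polynomial.induction_on' with
  | add f g hf hg => simp only [map_add, coeff_add, hf, hg]
  | monomial n a =>
    induction a using Polynomial.induction_on' with
    | add f g hf hg => simp only [map_add, coeff_add, hf, hg]
    | monomial m c =>
      rw [Bivariate.swap_monomial_monomial]
      simp only [coeff_monomial]
      split_ifs <;> simp_all [coeff_monomial]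

lemma natDegree_le_of_forall_coeff_ne_zero {R : Type*} [Semiring R] {f : R[X]} {n : ℕ}
    (h : ∀ i, f.coeff i ≠ 0 → i ≤ n) : f.natDegree ≤ n := by
  rw [natDegree_le_iff_coeff_eq_zero]
  intro i hi
  by_contra h0
  exact absurd (h i h0) (not_le.2 hi)

lemma natDegree_swap_eq_bivariateHeight {R : Type*} [CommSemiring R] (P : R[X][Y]) :
    (swap P).natDegree = bivariateHeight P := by
  apply le_antisymm
  · refine natDegree_le_of_forall_coeff_ne_zero fun i hi => ?_
    obtain ⟨j, hj⟩ : ∃ j, ((swap P).coeff i).coeff j ≠ 0 := by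
      by_contra! h
      exact hi (Polynomial.ext h)
    rw [coeff_coeff_swap] at hj
    refine (le_natDegree_of_ne_zero hj).trans
      (Finset.le_sup (f := fun j => (P.coeff j).natDegree) (mem_support_iff.2 ?_))
    intro h
    simp [h] at hj
  · refine Finset.sup_le fun j _ => natDegree_le_of_forall_coeff_ne_zero fun i hi => ?_
    rw [← coeff_coeff_swap] at hi
    apply le_natDegree_of_ne_zero
    intro h
    simp [h] at hi

lemma finite_setOf_support_subset {R : Type*} [CommSemiring R] [Fintype R]
    (I : Finset (ℕ × ℕ)) :
    {S : R[X][Y] | ∀ i j, (S.coeff j).coeff i ≠ 0 → (i, j) ∈ I}.Finite ∧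
      {S : R[X][Y] | ∀ i j, (S.coeff j).coeff i ≠ 0 → (i, j) ∈ I}.ncard
        ≤ Fintype.card R ^ I.card := by
  set A := {S : R[X][Y] | ∀ i j, (S.coeff j).coeff i ≠ 0 → (i, j) ∈ I}
  let f : A → (I → R) := fun S x => (S.1.coeff x.1.2).coeff x.1.1
  have hf : Function.Injective f := by
    rintro ⟨S, hS⟩ ⟨T, hT⟩ h
    rw [Subtype.mk.injEq]
    ext j i
    by_cases hx : (i, j) ∈ I
    · exact congrFun h ⟨(i, j), hx⟩
    · rw [not_not.1 (mt (hS i j) hx), not_not.1 (mt (hT i j) hx)]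
  have : Finite A := Finite.of_injective f hf
  refine ⟨A.toFinite, ?_⟩
  have h := Nat.card_le_card_of_injective f hf
  rwa [Nat.card_coe_set_eq, Nat.card_fun, Nat.card_eq_fintype_card, Nat.card_eq_fintype_card,
    Fintype.card_coe] at h

section Cartier

variable {K : Type*} [Field K] [Fintype K] {P S T : K[X][Y]} {h d : ℕ}

lemma card_sub_one_mul_add (n : ℕ) :
    n + (Fintype.card K - 1) * n = Fintype.card K * n := by
  rw [Nat.sub_mul, one_mul, Nat.add_sub_cancel']
  exact Nat.le_mul_of_pos_left _ Fintype.card_pos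

lemma coeff_coeff_bicartier (r i j : ℕ) :
    ((bicartier P r S).coeff j).coeff i
      = ((S * P ^ (Fintype.card K - 1)).coeff
          (Fintype.card K * j + (Fintype.card K - 1))).coeff (Fintype.card K * i + r) := by
  rw [bicartier, coeff_bidecimate Fintype.card_ne_zero, coeff_decimate Fintype.card_ne_zero]

lemma natDegree_bicartier_le (hP : P.natDegree ≤ d + 1) (hS : S.natDegree ≤ d) (r : ℕ) :
    (bicartier P r S).natDegree ≤ d := by
  refine natDegree_le_of_forall_coeff_ne_zero fun j hj => ?_
  rw [bicartier, coeff_bidecimate Fintype.card_ne_zero] at hj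
  have h1 : Fintype.card K * j + (Fintype.card K - 1)
      ≤ S.natDegree + (Fintype.card K - 1) * P.natDegree := by
    refine (le_natDegree_of_ne_zero fun h0 => hj ?_).trans
      (natDegree_mul_le.trans (Nat.add_le_add_left natDegree_pow_le _))
    rw [h0, decimate_zero]
  have h2 := Nat.mul_le_mul_left (Fintype.card K - 1) hP
  have h3 := card_sub_one_mul_add (K := K) (d + 1)
  have h4 := Fintype.card_pos (α := K)
  have : Fintype.card K * j < Fintype.card K * (d + 1) := by omega
  exact Nat.lt_succ_iff.1 (Nat.lt_of_mul_lt_mul_left this)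

/-- The hypothesis `hab` covers three uses: $a=b=h$ with $r=0$; the drop from $a=h$ to $b=h-1$ when
$r>0$; and the persistence of $a=b=h-1$ for every $r$. -/
lemma natDegree_swap_bicartier_le {a b r : ℕ} (hP : (swap P).natDegree ≤ h)
    (hS : (swap S).natDegree ≤ a)
    (hab : a + (Fintype.card K - 1) * h < Fintype.card K * (b + 1) + r) :
    (swap (bicartier P r S)).natDegree ≤ b := by
  refine natDegree_le_of_forall_coeff_ne_zero fun i hi => ?_
  obtain ⟨j, hj⟩ : ∃ j, ((swap (bicartier P r S)).coeff i).coeff j ≠ 0 := by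
    by_contra! h
    exact hi (Polynomial.ext h)
  rw [coeff_coeff_swap, coeff_coeff_bicartier, ← coeff_coeff_swap, map_mul, map_pow] at hj
  have h1 : Fintype.card K * i + r
      ≤ (swap S).natDegree + (Fintype.card K - 1) * (swap P).natDegree := by
    refine (le_natDegree_of_ne_zero fun h0 => hj ?_).trans
      (natDegree_mul_le.trans (Nat.add_le_add_left natDegree_pow_le _))
    rw [h0, coeff_zero]
  have h2 := Nat.mul_le_mul_left (Fintype.card K - 1) hP
  have : Fintype.card K * i < Fintype.card K * (b + 1) := by omega
  exact Nat.lt_succ_iff.1 (Nat.lt_of_mul_lt_mul_left this)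

/-- The exponent $qh=h+(q-1)h$ is the largest possible in $SP^{q-1}$, so only the extreme
coefficients of $S$ and $P$ enter. -/
lemma coeff_swap_bicartier_top (hP : (swap P).natDegree ≤ h) (hS : (swap S).natDegree ≤ h) :
    (swap (bicartier P 0 S)).coeff h = cartier ((swap P).coeff h) ((swap S).coeff h) := by
  ext j
  rw [coeff_coeff_swap, coeff_coeff_bicartier, ← coeff_coeff_swap, map_mul, map_pow, cartier,
    coeff_decimate Fintype.card_ne_zero, add_zero, ← card_sub_one_mul_add,
    coeff_mul_add_eq_of_natDegree_le hS, coeff_pow_of_natDegree_le hP]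
  exact natDegree_pow_le.trans (Nat.mul_le_mul_left _ hP)

lemma coeff_swap_bicartier_zero :
    (swap (bicartier P 0 S)).coeff 0 = cartier ((swap P).coeff 0) ((swap S).coeff 0) := by
  ext j
  rw [coeff_coeff_swap, coeff_coeff_bicartier, ← coeff_coeff_swap, map_mul, map_pow, cartier,
    coeff_decimate Fintype.card_ne_zero, add_zero, mul_zero, mul_coeff_zero,
    coeff_zero_eq_eval_zero (_ ^ _), eval_pow, ← coeff_zero_eq_eval_zero]

/-- Again only extreme coefficients enter. In $x$ the residue class is $0$ instead of $q-1$; the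
factor $X$ in the denominator contributes the shift by $X^{q-1}$. -/
lemma coeff_bicartier_top (hP : P.natDegree ≤ d + 1) (hS : S.natDegree ≤ d) :
    (bicartier P 0 S).coeff d = cartier (X * P.coeff (d + 1)) (S.coeff d) := by
  have h1 : Fintype.card K * d + (Fintype.card K - 1) = d + (Fintype.card K - 1) * (d + 1) := by
    rw [mul_add, mul_one, ← add_assoc, card_sub_one_mul_add]
  ext i
  rw [coeff_coeff_bicartier, cartier, coeff_decimate Fintype.card_ne_zero, h1, add_zero,
    coeff_mul_add_eq_of_natDegree_le hS, coeff_pow_of_natDegree_le hP, mul_pow, mul_left_comm,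
    coeff_X_pow_mul]
  exact natDegree_pow_le.trans (Nat.mul_le_mul_left _ hP)

end Cartier

end Polynomial

/-! ### A subexponential common multiple of the factor degrees -/

lemma Finset.card_sq_le_two_mul_sum (D : Finset ℕ) (hD : 0 ∉ D) :
    D.card ^ 2 ≤ 2 * ∑ x ∈ D, x := by
  induction D using Finset.induction_on_max with
  | empty => simp
  | insert a s hs ih =>
    have ha : a ∉ s := fun h => lt_irrefl _ (hs a h)
    rw [Finset.mem_insert, not_or] at hD
    have hcard : s.card ≤ a - 1 := by
      have hsub : s ⊆ Finset.Ioo 0 a := fun x hx =>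
        Finset.mem_Ioo.2 ⟨Nat.pos_of_ne_zero fun h => hD.2 (h ▸ hx), hs x hx⟩
      simpa using Finset.card_le_card hsub
    rw [Finset.card_insert_of_notMem ha, Finset.sum_insert ha]
    have := ih hD.2
    have : 0 < a := Nat.pos_of_ne_zero fun h => hD.1 h.symm
    have : (s.card + 1) ^ 2 = s.card ^ 2 + 2 * s.card + 1 := by ring
    omega

namespace Polynomial

/-- The degrees of the irreducible factors of a polynomial of degree at most `n` have a
subexponential common multiple. -/
lemma exists_natDegree_dvd_of_irreducible_of_dvd {F : Type*} [Field F] {R : F[X]} (hR : R ≠ 0)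
    {n : ℕ} (hn : R.natDegree ≤ n) (hn0 : n ≠ 0) :
    ∃ N : ℕ, N ≠ 0 ∧ (∀ f : F[X], Irreducible f → f ∣ R → f.natDegree ∣ N) ∧
      N ≤ n ^ Nat.sqrt (2 * n) := by
  classical
  set m := UniqueFactorizationMonoid.normalizedFactors R with hm
  set D := (m.map natDegree).toFinset with hD
  have hsum : ∑ x ∈ D, x ≤ n := by
    have h1 : m.prod.natDegree = (m.map natDegree).sum :=
      natDegree_multiset_prod _ (UniqueFactorizationMonoid.zero_notMem_normalizedFactors R)
    have h2 : m.prod.natDegree = R.natDegree :=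
      natDegree_eq_of_degree_eq (degree_eq_degree_of_associated
        (UniqueFactorizationMonoid.prod_normalizedFactors hR))
    refine le_trans ?_ hn
    rw [← h2, h1, Finset.sum_multiset_count]
    refine Finset.sum_le_sum fun x hx => ?_
    rw [smul_eq_mul]
    exact Nat.le_mul_of_pos_left _ (Multiset.count_pos.2 (Multiset.mem_toFinset.1 hx))
  have h0 : 0 ∉ D := by
    rw [hD, Multiset.mem_toFinset, Multiset.mem_map]
    rintro ⟨f, hf, hf0⟩
    exact (UniqueFactorizationMonoid.irreducible_of_normalized_factor f hf).natDegree_pos.ne' hf0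
  have hprod : ∏ x ∈ D, x ≠ 0 := Finset.prod_ne_zero_iff.2 fun x hx h => h0 (h ▸ hx)
  have hdvd : D.lcm id ∣ ∏ x ∈ D, x := Finset.lcm_dvd fun x hx => Finset.dvd_prod_of_mem _ hx
  refine ⟨D.lcm id, fun h => hprod (by rwa [h, zero_dvd_iff] at hdvd), fun f hf hfR => ?_, ?_⟩
  · obtain ⟨g, hg, hfg⟩ :=
      UniqueFactorizationMonoid.exists_mem_normalizedFactors_of_dvd hR hf hfR
    rw [natDegree_eq_of_degree_eq (degree_eq_degree_of_associated hfg)]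
    exact Finset.dvd_lcm (f := id)
      (Multiset.mem_toFinset.2 (Multiset.mem_map_of_mem natDegree hg))
  -- The distinct degrees are positive with sum at most $n$, so there are at most $\sqrt{2n}$ of
  -- them, each at most $n$.
  · calc D.lcm id ≤ ∏ x ∈ D, x := Nat.le_of_dvd (Nat.pos_of_ne_zero hprod) hdvd
      _ ≤ n ^ D.card := Finset.prod_le_pow_card _ _ _ fun x hx =>
          (Finset.single_le_sum (f := fun x => x) (fun _ _ => Nat.zero_le _) hx).trans hsum
      _ ≤ n ^ Nat.sqrt (2 * n) := by
          refine Nat.pow_le_pow_right (Nat.pos_of_ne_zero hn0) ?_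
          rw [Nat.le_sqrt, ← sq]
          exact (D.card_sq_le_two_mul_sum h0).trans (Nat.mul_le_mul_left 2 hsum)

end Polynomial

/-! ### Counting numerators and kernel elements -/

lemma Function.iterate_add_mul_of_iterate_add {α : Type*} {f : α → α} {x : α} {N k : ℕ}
    (h : f^[N + k] x = f^[k] x) (j t : ℕ) : f^[k + j + N * t] x = f^[k + j] x := by
  induction t with
  | zero => rfl
  | succ t ih =>
    rw [← ih, show k + j + N * (t + 1) = (j + N * t) + (N + k) by ring,
      show k + j + N * t = (j + N * t) + k by ring, Function.iterate_add_apply, h,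
      ← Function.iterate_add_apply]

namespace Polynomial

open scoped Polynomial.Bivariate

open Bivariate (swap)

lemma natDegree_coeff_le_natDegree_swap {R : Type*} [CommSemiring R] (P : R[X][Y]) (j : ℕ) :
    (P.coeff j).natDegree ≤ (swap P).natDegree := by
  refine natDegree_le_of_forall_coeff_ne_zero fun i hi => le_natDegree_of_ne_zero fun h => hi ?_
  rw [← coeff_coeff_swap, h, coeff_zero]

lemma natDegree_coeff_swap_le_natDegree {R : Type*} [CommSemiring R] (P : R[X][Y]) (i : ℕ) :
    ((swap P).coeff i).natDegree ≤ P.natDegree := by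
  simpa only [Bivariate.swap_swap_apply] using natDegree_coeff_le_natDegree_swap (swap P) i

section InitialNumerator

variable {K : Type*} [Field K] {P : K[X][Y]} {F : PowerSeries K} {d : ℕ}

/-- The numerator of the representation of `F` with denominator `∂P/∂y`. -/
noncomputable def initialNumerator (P : K[X][Y]) : K[X][Y] :=
  X * derivative P - (P.natDegree : K[X][Y]) * P

lemma coeff_initialNumerator (P : K[X][Y]) (j : ℕ) :
    (initialNumerator P).coeff j = ((j : K[X]) - P.natDegree) * P.coeff j := by
  rw [initialNumerator, coeff_sub, coeff_natCast_mul]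
  cases j with
  | zero => simp
  | succ j =>
    rw [coeff_X_mul, coeff_derivative]
    push_cast
    ring

/-- The factor $j-\deg_y P$ kills the top coefficient. This is why a multiple of $P$, which vanishes
at $y=F$, is subtracted. -/
lemma natDegree_initialNumerator_le (hP : P.natDegree = d + 1) :
    (initialNumerator P).natDegree ≤ d := by
  refine natDegree_le_of_forall_coeff_ne_zero fun j hj => ?_
  rw [coeff_initialNumerator] at hj
  have h1 : j ≤ P.natDegree := le_natDegree_of_ne_zero (right_ne_zero_of_mul hj)
  have h2 : j ≠ P.natDegree := by
    rintro rfl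
    simp at hj
  omega

lemma natDegree_swap_initialNumerator_le (P : K[X][Y]) :
    (swap (initialNumerator P)).natDegree ≤ (swap P).natDegree := by
  refine natDegree_le_of_forall_coeff_ne_zero fun i hi => ?_
  obtain ⟨j, hj⟩ : ∃ j, ((swap (initialNumerator P)).coeff i).coeff j ≠ 0 := by
    by_contra! h
    exact hi (Polynomial.ext h)
  rw [coeff_coeff_swap, coeff_initialNumerator,
    show ((j : K[X]) - P.natDegree) = C ((j : K) - P.natDegree) by simp, coeff_C_mul,
    ← coeff_coeff_swap] at hj
  refine le_natDegree_of_ne_zero fun h0 => hj ?_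
  rw [h0, coeff_zero, mul_zero]

lemma seriesOf_initialNumerator (hF : IsFurstenbergSeries P F) :
    seriesOf P F (initialNumerator P) = F := by
  have hu : PowerSeries.constantCoeff (aevalAeval PowerSeries.X F (derivative P)) ≠ 0 := by
    rw [constantCoeff_aevalAeval, hF.constantCoeff_eq_zero]
    exact hF.derivative_ne_zero
  rw [seriesOf, initialNumerator, map_sub, map_mul, map_mul, hF.root, mul_zero, sub_zero,
    aevalAeval_Y, mul_assoc, PowerSeries.mul_inv_cancel _ hu, mul_one]

end InitialNumerator

section Cartier

variable {K : Type*} [Field K] [Fintype K] {P S : K[X][Y]} {F : PowerSeries K} {h d : ℕ}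

lemma natDegree_swap_bicartier_zero_le (hP : (swap P).natDegree ≤ h)
    (hS : (swap S).natDegree ≤ h) : (swap (bicartier P 0 S)).natDegree ≤ h := by
  refine natDegree_swap_bicartier_le hP hS ?_
  rw [card_sub_one_mul_add, add_zero, mul_add, mul_one]
  exact Nat.lt_add_of_pos_right Fintype.card_pos

lemma iterate_bicartier_bounds (hPx : (swap P).natDegree ≤ h) (hPy : P.natDegree ≤ d + 1)
    (hSx : (swap S).natDegree ≤ h) (hSy : S.natDegree ≤ d) (e : ℕ) :
    (swap ((bicartier P 0)^[e] S)).natDegree ≤ h ∧ ((bicartier P 0)^[e] S).natDegree ≤ d := by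
  induction e with
  | zero => exact ⟨hSx, hSy⟩
  | succ e ih =>
    rw [Function.iterate_succ_apply']
    exact ⟨natDegree_swap_bicartier_zero_le hPx ih.1, natDegree_bicartier_le hPy ih.2 0⟩

lemma iterate_bicartier_boundary (hPx : (swap P).natDegree ≤ h) (hPy : P.natDegree ≤ d + 1)
    (hSx : (swap S).natDegree ≤ h) (hSy : S.natDegree ≤ d) (e : ℕ) :
    (swap ((bicartier P 0)^[e] S)).coeff h
        = (cartier ((swap P).coeff h))^[e] ((swap S).coeff h) ∧
      (swap ((bicartier P 0)^[e] S)).coeff 0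
        = (cartier ((swap P).coeff 0))^[e] ((swap S).coeff 0) ∧
      ((bicartier P 0)^[e] S).coeff d
        = (cartier (X * P.coeff (d + 1)))^[e] (S.coeff d) := by
  induction e with
  | zero => exact ⟨rfl, rfl, rfl⟩
  | succ e ih =>
    obtain ⟨hx, hy⟩ := iterate_bicartier_bounds hPx hPy hSx hSy e
    simp only [Function.iterate_succ_apply']
    rw [coeff_swap_bicartier_top hPx hx, coeff_swap_bicartier_zero, coeff_bicartier_top hPy hy,
      ih.1, ih.2.1, ih.2.2]
    exact ⟨rfl, rfl, rfl⟩

theorem range_iterate_bicartier (hPx : (swap P).natDegree = h + 1) (hPy : P.natDegree = d + 1)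
    (hP0 : (swap P).coeff 0 ≠ 0) (hSx : (swap S).natDegree ≤ h + 1) (hSy : S.natDegree ≤ d) :
    (Set.range fun e => (bicartier P 0)^[e] S).Finite ∧
      (Set.range fun e => (bicartier P 0)^[e] S).ncard
        ≤ (h + d + 2) + (2 * (h + d + 2)) ^ Nat.sqrt (2 * (2 * (h + d + 2)))
            * Fintype.card K ^ (h * d) := by
  classical
  set m := h + d + 2 with hm
  set A := (swap P).coeff (h + 1) with hA
  set B := (swap P).coeff 0 with hB
  set C' := X * P.coeff (d + 1) with hC
  have hA0 : A ≠ 0 := by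
    rw [hA, ← hPx, coeff_natDegree, leadingCoeff_ne_zero]
    intro h0
    rw [h0, natDegree_zero] at hPx
    omega
  have hC0 : C' ≠ 0 := by
    refine mul_ne_zero X_ne_zero ?_
    rw [← hPy, coeff_natDegree, leadingCoeff_ne_zero]
    rintro rfl
    rw [natDegree_zero] at hPy
    omega
  have hAd : A.natDegree ≤ d + 1 := hPy ▸ natDegree_coeff_swap_le_natDegree P _
  have hBd : B.natDegree ≤ d + 1 := hPy ▸ natDegree_coeff_swap_le_natDegree P _
  have hCd : C'.natDegree ≤ h + 2 := by
    have := natDegree_coeff_le_natDegree_swap P (d + 1)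
    refine natDegree_mul_le.trans ?_
    rw [natDegree_X]
    omega
  -- One period for all three boundary operators: $\deg(ABC')\le 2(d+1)+(h+2)\le 2m$.
  obtain ⟨N, hN0, hN, hNle⟩ := exists_natDegree_dvd_of_irreducible_of_dvd
    (mul_ne_zero (mul_ne_zero hA0 hP0) hC0) (n := 2 * m)
    (by rw [natDegree_mul (mul_ne_zero hA0 hP0) hC0, natDegree_mul hA0 hP0]; omega) (by omega)
  -- Thus $m$, a bound for the degrees, also serves as the preperiod.
  have hmq : m < Fintype.card K ^ m := Nat.lt_pow_self Fintype.one_lt_card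
  have hperiod : ∀ R T : K[X], R ≠ 0 → R.natDegree ≤ m → T.natDegree < m → R ∣ A * B * C' →
      ∀ j t, (cartier R)^[m + j + N * t] T = (cartier R)^[m + j] T := by
    intro R T hR hRm hT hdvd
    refine Function.iterate_add_mul_of_iterate_add ?_
    exact iterate_cartier_add hR hRm
      (fun j hj => (le_natDegree_of_ne_zero hj).trans_lt hT) hmq hN0
      fun f hf hfR => hN f hf (hfR.trans hdvd)
  set I : Finset (ℕ × ℕ) := Finset.Ioo 0 (h + 1) ×ˢ Finset.range d with hI
  have hIcard : I.card = h * d := by simp [hI]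
  obtain ⟨hfin, hcard⟩ := finite_setOf_support_subset (R := K) I
  -- Iterates whose indices differ by a multiple of $N$ agree on the three boundary lines, so their
  -- difference is supported on the $hd$ interior cells.
  have hmem : ∀ j t, (bicartier P 0)^[m + j + N * t] S - (bicartier P 0)^[m + j] S ∈
      {S : K[X][Y] | ∀ i j, (S.coeff j).coeff i ≠ 0 → (i, j) ∈ I} := by
    intro j t
    obtain ⟨hx1, hy1⟩ := iterate_bicartier_bounds hPx.le hPy.le hSx hSy (m + j + N * t)
    obtain ⟨hx2, hy2⟩ := iterate_bicartier_bounds hPx.le hPy.le hSx hSy (m + j)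
    obtain ⟨ht1, hb1, hr1⟩ := iterate_bicartier_boundary hPx.le hPy.le hSx hSy (m + j + N * t)
    obtain ⟨ht2, hb2, hr2⟩ := iterate_bicartier_boundary hPx.le hPy.le hSx hSy (m + j)
    have hrow : ∀ i, ((swap S).coeff i).natDegree < m := fun i =>
      (natDegree_coeff_swap_le_natDegree S i).trans_lt (by omega)
    rw [hperiod A _ hA0 (by omega) (hrow _) ⟨B * C', by ring⟩, ← ht2] at ht1
    rw [hperiod B _ hP0 (by omega) (hrow _) ⟨A * C', by ring⟩, ← hb2] at hb1
    rw [hperiod C' _ hC0 (by omega)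
      ((natDegree_coeff_le_natDegree_swap S d).trans_lt (by omega)) ⟨A * B, by ring⟩,
      ← hr2] at hr1
    generalize (bicartier P 0)^[m + j + N * t] S = S1 at *
    generalize (bicartier P 0)^[m + j] S = S2 at *
    intro i j hij
    have hi : i ≤ h + 1 := by
      rw [← coeff_coeff_swap, map_sub] at hij
      refine (le_natDegree_of_ne_zero fun h0 => hij ?_).trans ((natDegree_sub_le_of_le hx1 hx2).trans_eq (max_self _))
      rw [h0, coeff_zero]
    have hj : j ≤ d := by
      refine (le_natDegree_of_ne_zero fun h0 => hij ?_).trans ((natDegree_sub_le_of_le hy1 hy2).trans_eq (max_self _))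
      rw [h0, coeff_zero]
    have hi1 : i ≠ h + 1 := by
      rintro rfl
      rw [← coeff_coeff_swap, map_sub, coeff_sub, ht1, sub_self, coeff_zero] at hij
      exact hij rfl
    have hi0 : i ≠ 0 := by
      rintro rfl
      rw [← coeff_coeff_swap, map_sub, coeff_sub, hb1, sub_self, coeff_zero] at hij
      exact hij rfl
    have hjd : j ≠ d := by
      rintro rfl
      rw [coeff_sub, hr1, sub_self, coeff_zero] at hij
      exact hij rfl
    rw [hI, Finset.mem_product, Finset.mem_Ioo, Finset.mem_range]
    omega
  set G : Finset K[X][Y] := (Finset.range m).image (fun e => (bicartier P 0)^[e] S) ∪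
    (Finset.range N).biUnion fun j =>
      hfin.toFinset.image fun U => U + (bicartier P 0)^[m + j] S with hG
  have hsub : (Set.range fun e => (bicartier P 0)^[e] S) ⊆ G := by
    rintro _ ⟨e, rfl⟩
    rw [hG, Finset.mem_coe, Finset.mem_union]
    by_cases he : e < m
    · exact Or.inl (Finset.mem_image.2 ⟨e, Finset.mem_range.2 he, rfl⟩)
    · right
      refine Finset.mem_biUnion.2 ⟨(e - m) % N,
        Finset.mem_range.2 (Nat.mod_lt _ (Nat.pos_of_ne_zero hN0)),
        Finset.mem_image.2 ⟨_, hfin.mem_toFinset.2 (hmem ((e - m) % N) ((e - m) / N)), ?_⟩⟩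
      rw [sub_add_cancel, add_assoc, Nat.mod_add_div, Nat.add_sub_cancel' (not_lt.1 he)]
  refine ⟨G.finite_toSet.subset hsub, ?_⟩
  calc _ ≤ (G : Set K[X][Y]).ncard := Set.ncard_le_ncard hsub G.finite_toSet
    _ = G.card := Set.ncard_coe_finset G
    _ ≤ m + N * Fintype.card K ^ (h * d) := by
      refine (Finset.card_union_le _ _).trans (Nat.add_le_add ?_ ?_)
      · exact Finset.card_image_le.trans_eq (Finset.card_range m)
      · refine (Finset.card_biUnion_le_card_mul _ _ (Fintype.card K ^ (h * d))
          fun j _ => ?_).trans_eq (by rw [Finset.card_range])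
        refine Finset.card_image_le.trans ?_
        rw [← Set.ncard_eq_toFinset_card _ hfin, ← hIcard]
        exact hcard
    _ ≤ _ := Nat.add_le_add_left (Nat.mul_le_mul_right _ hNle) _

lemma qKernel_subset (hF : IsFurstenbergSeries P F) (hPx : (swap P).natDegree = h + 1)
    (hPy : P.natDegree = d + 1) :
    qKernel (Fintype.card K) (fun n => PowerSeries.coeff n F) ⊆
      (fun (S : K[X][Y]) (n : ℕ) => PowerSeries.coeff n (seriesOf P F S)) ''
        ((Set.range fun e => (bicartier P 0)^[e] (initialNumerator P)) ∪
          {S : K[X][Y] | ∀ i j, (S.coeff j).coeff i ≠ 0 →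
            (i, j) ∈ Finset.range (h + 1) ×ˢ Finset.range (d + 1)}) := by
  have hbox : ∀ S : K[X][Y], (swap S).natDegree ≤ h → S.natDegree ≤ d →
      S ∈ {S : K[X][Y] | ∀ i j, (S.coeff j).coeff i ≠ 0 →
            (i, j) ∈ Finset.range (h + 1) ×ˢ Finset.range (d + 1)} := by
    intro S hx hy i j hij
    rw [Finset.mem_product, Finset.mem_range, Finset.mem_range, Nat.lt_succ_iff,
      Nat.lt_succ_iff]
    constructor
    · refine (le_natDegree_of_ne_zero fun h0 => hij ?_).trans hx
      rw [← coeff_coeff_swap, h0, coeff_zero]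
    · refine (le_natDegree_of_ne_zero fun h0 => hij ?_).trans hy
      rw [h0, coeff_zero]
  have hstep : ∀ (S : K[X][Y]) (r n : ℕ), r < Fintype.card K →
      PowerSeries.coeff (Fintype.card K * n + r) (seriesOf P F S)
        = PowerSeries.coeff n (seriesOf P F (bicartier P r S)) := by
    intro S r n hr
    rw [← decimate_seriesOf hF hr, PowerSeries.coeff_decimate]
  have hq : 0 < Fintype.card K := Fintype.card_pos
  -- The dichotomy is whether all digits read so far are zero.
  have key : ∀ e r : ℕ, r < Fintype.card K ^ e → ∃ S : K[X][Y],
      (∀ n, PowerSeries.coeff (Fintype.card K ^ e * n + r) F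
        = PowerSeries.coeff n (seriesOf P F S)) ∧
      (r = 0 ∧ S = (bicartier P 0)^[e] (initialNumerator P) ∨
        (swap S).natDegree ≤ h ∧ S.natDegree ≤ d) := by
    intro e
    induction e with
    | zero =>
      intro r hr
      rw [pow_zero, Nat.lt_one_iff] at hr
      subst hr
      refine ⟨initialNumerator P, fun n => ?_, Or.inl ⟨rfl, rfl⟩⟩
      rw [seriesOf_initialNumerator hF, pow_zero, one_mul, add_zero]
    | succ e ih =>
      intro r hr
      have hqe : 0 < Fintype.card K ^ e := pow_pos hq e
      obtain ⟨S, hS, hS'⟩ := ih (r % Fintype.card K ^ e) (Nat.mod_lt _ hqe)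
      have hr2 : r / Fintype.card K ^ e < Fintype.card K :=
        Nat.div_lt_of_lt_mul (by rwa [← pow_succ])
      have hr3 := Nat.div_add_mod r (Fintype.card K ^ e)
      generalize r / Fintype.card K ^ e = s at hr2 hr3
      generalize r % Fintype.card K ^ e = t at hS hS' hr3
      subst hr3
      refine ⟨bicartier P s S, fun n => ?_, ?_⟩
      · rw [← hstep S s n hr2, ← hS]
        congr 2
        rw [pow_succ]
        ring
      · obtain ⟨rfl, rfl⟩ | ⟨hx, hy⟩ := hS'
        · obtain ⟨hx, hy⟩ := iterate_bicartier_bounds hPx.le hPy.le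
            ((natDegree_swap_initialNumerator_le P).trans_eq hPx)
            (natDegree_initialNumerator_le hPy) e
          -- A zero digit continues the orbit; a positive digit gives the strict inequality that
          -- lowers the height by one.
          obtain rfl | hs := Nat.eq_zero_or_pos s
          · left
            rw [Function.iterate_succ_apply']
            simp
          · right
            refine ⟨natDegree_swap_bicartier_le hPx.le hx ?_, natDegree_bicartier_le hPy.le hy s⟩
            rw [card_sub_one_mul_add]
            omega
        · right
          refine ⟨natDegree_swap_bicartier_le hPx.le hx ?_, natDegree_bicartier_le hPy.le hy s⟩
          have := card_sub_one_mul_add (K := K) (h + 1)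
          omega
  rintro _ ⟨e, r, hr, rfl⟩
  obtain ⟨S, hS, ⟨-, rfl⟩ | ⟨hx, hy⟩⟩ := key e r hr
  · exact ⟨_, Or.inl ⟨e, rfl⟩, _root_.funext fun n => (hS n).symm⟩
  · exact ⟨S, Or.inr (hbox S hx hy), _root_.funext fun n => (hS n).symm⟩

theorem qKernel_furstenberg (hF : IsFurstenbergSeries P F) (hPx : (swap P).natDegree = h + 1)
    (hPy : P.natDegree = d + 1) :
    (qKernel (Fintype.card K) (fun n => PowerSeries.coeff n F)).Finite ∧
      (qKernel (Fintype.card K) (fun n => PowerSeries.coeff n F)).ncard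
        ≤ Fintype.card K ^ ((h + 1) * (d + 1)) + ((h + d + 2)
          + (2 * (h + d + 2)) ^ Nat.sqrt (2 * (2 * (h + d + 2))) * Fintype.card K ^ (h * d)) := by
  have hP0 : (swap P).coeff 0 ≠ 0 := by
    intro h0
    apply hF.derivative_ne_zero
    have h1 : ∀ j, (P.coeff j).coeff 0 = 0 := fun j => by
      rw [← coeff_coeff_swap, h0, coeff_zero]
    rw [evalEval, C_0, ← coeff_zero_eq_eval_zero, ← coeff_zero_eq_eval_zero, coeff_derivative]
    simp [h1]
  obtain ⟨hf1, hc1⟩ := range_iterate_bicartier hPx hPy hP0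
    ((natDegree_swap_initialNumerator_le P).trans_eq hPx) (natDegree_initialNumerator_le hPy)
  obtain ⟨hf2, hc2⟩ := finite_setOf_support_subset (R := K)
    (Finset.range (h + 1) ×ˢ Finset.range (d + 1))
  rw [Finset.card_product, Finset.card_range, Finset.card_range] at hc2
  have hsub := qKernel_subset hF hPx hPy
  have hfin := (hf1.union hf2).image
    (fun (S : K[X][Y]) (n : ℕ) => PowerSeries.coeff n (seriesOf P F S))
  refine ⟨hfin.subset hsub, (Set.ncard_le_ncard hsub hfin).trans
    ((Set.ncard_image_le (hf1.union hf2)).trans ((Set.ncard_union_le _ _).trans ?_))⟩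
  rw [add_comm]
  exact Nat.add_le_add hc2 hc1

end Cartier

/-- Here $P=y\,G(y)$ with constant coefficients and $G(0)=P_y(0,0)\neq0$, so $G(F)\ne0$ and the root
must be $F=0$. -/
lemma eq_zero_of_bivariateHeight_eq_zero {K : Type*} [Field K] {P : K[X][Y]} {F : PowerSeries K}
    (hF : IsFurstenbergSeries P F) (hP : bivariateHeight P = 0) : F = 0 := by
  have h0 : P.coeff 0 = 0 := by
    have h1 : (P.coeff 0).natDegree = 0 := by
      have := natDegree_coeff_le_natDegree_swap P 0
      rw [natDegree_swap_eq_bivariateHeight, hP] at this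
      omega
    have h2 := hF.eval_zero
    rw [evalEval, C_0, ← coeff_zero_eq_eval_zero, ← coeff_zero_eq_eval_zero] at h2
    rw [eq_C_of_natDegree_eq_zero h1, h2, C_0]
  have hX : P = divX P * X := by
    conv_lhs => rw [← divX_mul_X_add P, h0, C_0, add_zero]
  have hroot := hF.root
  rw [hX, map_mul, aevalAeval_Y] at hroot
  refine (mul_eq_zero.1 hroot).resolve_left fun h => hF.derivative_ne_zero ?_
  have h3 := congrArg PowerSeries.constantCoeff h
  rw [constantCoeff_aevalAeval, hF.constantCoeff_eq_zero, map_zero, evalEval, C_0,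
    ← coeff_zero_eq_eval_zero, ← coeff_zero_eq_eval_zero, coeff_divX] at h3
  rw [evalEval, C_0, ← coeff_zero_eq_eval_zero, ← coeff_zero_eq_eval_zero, coeff_derivative,
    mul_coeff_zero, h3, zero_mul]

end Polynomial

/-! ### From the kernel to an automaton -/

lemma mem_qKernel_comp {A : Type*} {q : ℕ} {a b : ℕ → A} (hb : b ∈ qKernel q a) (s : Fin q) :
    (fun n => b (q * n + s)) ∈ qKernel q a := by
  obtain ⟨e, r, hr, rfl⟩ := hb
  refine ⟨e + 1, q ^ e * s + r, ?_, ?_⟩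
  · calc q ^ e * s + r < q ^ e * s + q ^ e := Nat.add_lt_add_left hr _
      _ = q ^ e * (s + 1) := by ring
      _ ≤ q ^ (e + 1) := by rw [pow_succ]; exact Nat.mul_le_mul_left _ s.2
  · funext n
    change a _ = a _
    congr 1
    ring

/-- The automaton whose states are the elements of the `q`-kernel, labelled by `φ`. -/
def kernelAutomaton {A σ : Type*} (q : ℕ) (a : ℕ → A) (φ : σ ≃ qKernel q a) :
    AutomatonWithOutput q A σ where
  start := φ.symm ⟨a, 0, 0, by simp, by simp⟩
  step x s := φ.symm ⟨fun n => (φ x).1 (q * n + s), mem_qKernel_comp (φ x).2 s⟩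
  output x := (φ x).1 0

lemma kernelAutomaton_foldl {A σ : Type*} (q : ℕ) (a : ℕ → A) (φ : σ ≃ qKernel q a)
    (w : List (Fin q)) (x : σ) (n : ℕ) :
    (φ (w.foldl (kernelAutomaton q a φ).step x)).1 n
      = (φ x).1 (q ^ w.length * n + Nat.ofDigits q (w.map Fin.val)) := by
  induction w generalizing x with
  | nil => simp
  | cons s w ih =>
    rw [List.foldl_cons, ih, List.map_cons, Nat.ofDigits_cons, List.length_cons]
    simp only [kernelAutomaton, Equiv.apply_symm_apply]
    refine congrArg (φ x).1 ?_
    ring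

lemma kernelAutomaton_run {A σ : Type*} (q : ℕ) (a : ℕ → A) (φ : σ ≃ qKernel q a)
    (w : List (Fin q)) :
    (kernelAutomaton q a φ).run w = a (Nat.ofDigits q (w.map Fin.val)) := by
  have h := kernelAutomaton_foldl q a φ w (kernelAutomaton q a φ).start 0
  rw [mul_zero, zero_add] at h
  refine h.trans ?_
  simp [kernelAutomaton]

theorem exists_isMinimalAutomatonSize_le {A : Type*} {q : ℕ} {a : ℕ → A}
    (h : (qKernel q a).Finite) :
    ∃ s, IsMinimalAutomatonSize q a s ∧ s ≤ (qKernel q a).ncard := by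
  have : Finite (qKernel q a) := h
  let φ : Fin (Nat.card (qKernel q a)) ≃ qKernel q a := (Finite.equivFin _).symm
  rw [← Nat.card_coe_set_eq]
  have hmem : Nat.card (qKernel q a) ∈ {N : ℕ | ∃ M : AutomatonWithOutput q A (Fin N),
      M.Generates a ∧ M.IgnoresLeadingZeros} := by
    refine ⟨kernelAutomaton q a φ, fun n w hw => ?_, fun w z k hz => ?_⟩
    · rw [kernelAutomaton_run, hw, Nat.ofDigits_digits]
    -- The output depends only on the number represented, which zeros in the most significant places
    -- do not change.
    · rw [kernelAutomaton_run, kernelAutomaton_run, List.map_append, List.map_replicate, hz,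
        Nat.ofDigits_append_replicate_zero]
  exact ⟨_, ⟨Nat.sInf_mem ⟨_, hmem⟩, fun _ hN => Nat.sInf_le hN⟩, Nat.sInf_le hmem⟩

lemma qKernel_zero {A : Type*} [Zero A] (q : ℕ) :
    qKernel q (fun _ => (0 : A)) = {fun _ => 0} := by
  ext b
  rw [Set.mem_singleton_iff]
  exact ⟨fun ⟨_, _, _, hb⟩ => hb, fun hb => ⟨0, 0, by simp, hb⟩⟩

/-! ### Asymptotics of the error term -/

/-- The number of exceptional states, up to a power of `q`, where `m` is the sum of the height and
the degree. -/
def exceptionalBound (m : ℕ) : ℕ :=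
  m + (2 * m) ^ Nat.sqrt (2 * (2 * m))

lemma eventually_pow_sqrt_le_exp :
    ∀ᶠ m : ℕ in atTop, (((2 * m) ^ Nat.sqrt (2 * (2 * m)) : ℕ) : ℝ) ≤ Real.exp (1 / 3) ^ m := by
  -- The constant is chosen so that $4m\cdot 2m/72=(m/3)^2$.
  have hlog : ∀ᶠ x : ℝ in atTop, Real.log x ^ 2 ≤ 1 / 72 * x := by
    filter_upwards [(Real.isLittleO_pow_log_id_atTop (n := 2)).def
      (show (0 : ℝ) < 1 / 72 by norm_num), eventually_ge_atTop 0] with x hx h0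
    simpa [abs_of_nonneg h0] using hx
  have ht : Tendsto (fun m : ℕ => ((2 * m : ℕ) : ℝ)) atTop atTop :=
    tendsto_natCast_atTop_atTop.comp (tendsto_id.const_mul_atTop' two_pos)
  filter_upwards [ht.eventually hlog, eventually_gt_atTop 0] with m hm h0
  set s := Nat.sqrt (2 * (2 * m)) with hs
  have hpos : (0 : ℝ) < ((2 * m : ℕ) : ℝ) := by positivity
  have hs2 : (s : ℝ) ^ 2 ≤ 4 * m := by
    have : s * s ≤ 2 * (2 * m) := Nat.sqrt_le _
    have : ((s * s : ℕ) : ℝ) ≤ ((2 * (2 * m) : ℕ) : ℝ) := Nat.cast_le.2 this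
    push_cast at this
    linarith
  have hkey : (s : ℝ) * Real.log ((2 * m : ℕ) : ℝ) ≤ m / 3 := by
    refine (le_abs_self _).trans (abs_le_of_sq_le_sq ?_ (by positivity))
    calc ((s : ℝ) * Real.log ((2 * m : ℕ) : ℝ)) ^ 2
        = (s : ℝ) ^ 2 * Real.log ((2 * m : ℕ) : ℝ) ^ 2 := by ring
      _ ≤ (4 * m) * (1 / 72 * ((2 * m : ℕ) : ℝ)) := by gcongr
      _ = (m / 3) ^ 2 := by push_cast; ring
  rw [← Real.exp_nat_mul, Nat.cast_pow, ← Real.exp_log (pow_pos hpos s), Real.log_pow]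
  exact Real.exp_le_exp.2 (hkey.trans_eq (by ring))

lemma tendsto_exceptionalBound_div :
    Tendsto (fun m : ℕ => (exceptionalBound m : ℝ) / 2 ^ (m - 1)) atTop (𝓝 0) := by
  have h1 : Tendsto (fun m : ℕ => (m : ℝ) / 2 ^ m) atTop (𝓝 0) := by
    simpa using tendsto_pow_const_div_const_pow_of_one_lt 1 (one_lt_two (α := ℝ))
  -- Cubing reduces this to $e<8$.
  have hlt : Real.exp (1 / 3) / 2 < 1 := by
    rw [div_lt_one two_pos]
    refine lt_of_pow_lt_pow_left₀ 3 zero_le_two ?_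
    rw [← Real.exp_nat_mul]
    have := Real.exp_one_lt_d9
    norm_num
    linarith
  have h2 : Tendsto (fun m : ℕ => (Real.exp (1 / 3) / 2) ^ m) atTop (𝓝 0) :=
    tendsto_pow_atTop_nhds_zero_of_lt_one (by positivity) hlt
  have h3 := (h1.add h2).const_mul 2
  rw [add_zero, mul_zero] at h3
  refine squeeze_zero' (Eventually.of_forall fun m => by positivity) ?_ h3
  filter_upwards [eventually_pow_sqrt_le_exp, eventually_gt_atTop 0] with m hm h0
  obtain ⟨k, rfl⟩ := Nat.exists_eq_succ_of_ne_zero h0.ne'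
  have h4 : (exceptionalBound (k + 1) : ℝ) ≤ ((k + 1 : ℕ) : ℝ) + Real.exp (1 / 3) ^ (k + 1) := by
    rw [exceptionalBound, Nat.cast_add]
    exact add_le_add_right hm _
  calc (exceptionalBound (k + 1) : ℝ) / 2 ^ (k + 1 - 1)
      ≤ (((k + 1 : ℕ) : ℝ) + Real.exp (1 / 3) ^ (k + 1)) / 2 ^ k := by
        rw [Nat.add_sub_cancel]; gcongr
    _ = _ := by rw [div_pow, pow_succ 2 k]; field_simp

/-- The error term in the bound for the size of the `q`-kernel. -/
noncomputable def kernelError (q h d : ℕ) : ℝ :=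
  if q < 2 ∨ h = 0 ∨ d = 0 then 0 else exceptionalBound (h + d) / (q : ℝ) ^ (h + d - 1)

lemma kernelError_nonneg (q h d : ℕ) : 0 ≤ kernelError q h d := by
  rw [kernelError]
  split_ifs <;> positivity

/-- Replacing $q$ by $2$ makes the bound depend on $h+d$ only, which serves both limits at fixed
$q$. The value $0$ for $q<2$ makes it hold for every natural number $q$. -/
lemma kernelError_le (q h d : ℕ) :
    kernelError q h d ≤ exceptionalBound (h + d) / 2 ^ (h + d - 1) := by
  rw [kernelError]
  split_ifs with hc
  · positivity
  · have : (2 : ℝ) ≤ q := by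
      push Not at hc
      exact_mod_cast hc.1
    gcongr

lemma tendsto_kernelError_card (h d : ℕ) :
    Tendsto (fun q => kernelError q h d) atTop (𝓝 0) := by
  by_cases hc : h = 0 ∨ d = 0
  · simp [kernelError, hc]
  -- With $h,d\ge1$ the power of $q$ is nontrivial; setting the error to $0$ when $h$ or $d$
  -- vanishes avoids the case of exponent $0$.
  · have hne : h + d - 1 ≠ 0 := by omega
    have ht : Tendsto (fun q : ℕ => (exceptionalBound (h + d) : ℝ) / (q : ℝ) ^ (h + d - 1))
        atTop (𝓝 0) :=
      Tendsto.const_div_atTop ((tendsto_pow_atTop hne).comp tendsto_natCast_atTop_atTop) _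
    refine ht.congr' ?_
    filter_upwards [eventually_ge_atTop 2] with q hq
    rw [kernelError, if_neg (by omega)]

lemma tendsto_kernelError_height (q d : ℕ) :
    Tendsto (fun h => kernelError q h d) atTop (𝓝 0) :=
  squeeze_zero (fun h => kernelError_nonneg q h d) (fun h => kernelError_le q h d)
    (tendsto_exceptionalBound_div.comp (tendsto_add_atTop_nat d))

lemma tendsto_kernelError_degree (q h : ℕ) :
    Tendsto (fun d => kernelError q h d) atTop (𝓝 0) := by
  refine squeeze_zero (fun d => kernelError_nonneg q h d) (fun d => kernelError_le q h d) ?_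
  simp only [add_comm h]
  exact tendsto_exceptionalBound_div.comp (tendsto_add_atTop_nat h)

/-! ### Assembly of the bounds -/

lemma IsFurstenbergSeries.natDegree_ne_zero {K : Type*} [Field K]
    {P : Polynomial (Polynomial K)} {F : PowerSeries K} (hF : IsFurstenbergSeries P F) :
    P.natDegree ≠ 0 := fun h0 => hF.derivative_ne_zero <| by
  rw [Polynomial.derivative_of_natDegree_zero h0, Polynomial.evalEval_zero]

theorem qKernel_ncard_le {K : Type*} [Field K] [Fintype K] {P : Polynomial (Polynomial K)}
    {F : PowerSeries K} (hF : IsFurstenbergSeries P F) :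
    (qKernel (Fintype.card K) (fun n => PowerSeries.coeff n F)).Finite ∧
      ((qKernel (Fintype.card K) (fun n => PowerSeries.coeff n F)).ncard : ℝ)
        ≤ (1 + kernelError (Fintype.card K) (bivariateHeight P) P.natDegree)
          * (Fintype.card K : ℝ) ^ (bivariateHeight P * P.natDegree) := by
  obtain hh | ⟨h, hh⟩ : bivariateHeight P = 0 ∨ ∃ h, bivariateHeight P = h + 1 := by
    cases bivariateHeight P <;> simp
  · have h0 : (fun n => PowerSeries.coeff n F) = fun _ => 0 := by
      rw [Polynomial.eq_zero_of_bivariateHeight_eq_zero hF hh]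
      simp
    rw [h0, qKernel_zero]
    refine ⟨Set.finite_singleton _, ?_⟩
    rw [Set.ncard_singleton, hh, zero_mul, pow_zero, mul_one, Nat.cast_one]
    exact le_add_of_nonneg_right (kernelError_nonneg _ _ _)
  · obtain ⟨d, hd⟩ := Nat.exists_eq_succ_of_ne_zero hF.natDegree_ne_zero
    rw [Nat.succ_eq_add_one] at hd
    obtain ⟨hfin, hcard⟩ := Polynomial.qKernel_furstenberg hF
      ((Polynomial.natDegree_swap_eq_bivariateHeight P).trans hh) hd
    refine ⟨hfin, ?_⟩
    have hq : 2 ≤ Fintype.card K := Fintype.one_lt_card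
    generalize Fintype.card K = q at hq hcard ⊢
    generalize (qKernel q fun n => PowerSeries.coeff n F).ncard = c at hcard ⊢
    rw [hh, hd, kernelError, if_neg (by omega), show h + 1 + (d + 1) = h + d + 2 by ring,
      show h + d + 2 - 1 = h + d + 1 by omega]
    have hpos : (0 : ℝ) < q := by positivity
    -- The full box exceeds the interior one by $h+d+1$ cells, which is the exponent in the
    -- denominator of `kernelError`.
    have hsplit : (q : ℝ) ^ ((h + 1) * (d + 1)) = q ^ (h + d + 1) * q ^ (h * d) := by
      rw [← pow_add]
      congr 1
      ring
    have hle : c ≤ q ^ ((h + 1) * (d + 1)) + exceptionalBound (h + d + 2) * q ^ (h * d) := by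
      refine hcard.trans (Nat.add_le_add_left ?_ _)
      rw [exceptionalBound, add_mul]
      exact Nat.add_le_add_right (Nat.le_mul_of_pos_right _ (by positivity)) _
    calc (c : ℝ) ≤ q ^ ((h + 1) * (d + 1)) + exceptionalBound (h + d + 2) * q ^ (h * d) := by
          exact_mod_cast hle
      _ = _ := by
          rw [hsplit, add_mul (1 : ℝ), one_mul, ← mul_assoc, div_mul_cancel₀ _ (pow_pos hpos _).ne']

theorem theorem2 :
    ∃ ε : ℕ → ℕ → ℕ → ℝ,
      (∀ h d : ℕ, Tendsto (fun q => ε q h d) atTop (𝓝 0)) ∧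
      (∀ q d : ℕ, Tendsto (fun h => ε q h d) atTop (𝓝 0)) ∧
      (∀ q h : ℕ, Tendsto (fun d => ε q h d) atTop (𝓝 0)) ∧
      ∀ (K : Type*) [Field K] [Fintype K] (q h d : ℕ) (P : Polynomial (Polynomial K))
        (F : PowerSeries K),
        Fintype.card K = q → bivariateHeight P = h → P.natDegree = d →
        IsFurstenbergSeries P F →
          (∃ s : ℕ, IsMinimalAutomatonSize q (fun n => PowerSeries.coeff n F) s ∧
            (s : ℝ) ≤ (1 + ε q h d) * (q : ℝ) ^ (h * d)) ∧
          (qKernel q (fun n => PowerSeries.coeff n F)).Finite ∧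
          ((qKernel q (fun n => PowerSeries.coeff n F)).ncard : ℝ) ≤
            (1 + ε q h d) * (q : ℝ) ^ (h * d) := by
  refine ⟨kernelError, tendsto_kernelError_card, tendsto_kernelError_height,
    tendsto_kernelError_degree, ?_⟩
  rintro K _ _ _ _ _ P F rfl rfl rfl hF
  obtain ⟨hfin, hle⟩ := qKernel_ncard_le hF
  obtain ⟨s, hs, hsle⟩ := exists_isMinimalAutomatonSize_le hfin
  exact ⟨⟨s, hs, (Nat.cast_le.2 hsle).trans hle⟩, hfin, hle⟩
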